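/- Let $[m]=\{1,\dots,m\}$, let $\mathfrak S_m$ be the set of permutations of $[m]$, and for an integer $j$ let $\langle j\rangle_m\in\{1,\dots,m\}$ be its representative modulo $m$. Write $\mathbf 1(P)=1$ if $P$ holds and $0$ otherwise, and $\{x\}=x-\lfloor x\rfloor$. We use the following notions, for $m\ge 1$. * $\mathcal V_m$ is the set of $\theta\in\mathfrak S_m$ with $\theta(i+1)-\theta(i)\equiv\theta(1)-\mathbf 1(\theta(m)\le\theta(i))\pmod m$ for all $i\in[m-1]$ (so $\mathcal V_1=\mathfrak S_1$). * For $\gcd(a,m)=1$ and $b\in\{0,1\}$, $\theta_{a,b}\in\mathfrak S_m$ is given by $\theta_{a,b}(i)=\langle ai+b\rangle_m$. * For $m\ge 2$, the projection of $\theta\in\mathcal V_m$ is $\Psi_m(\Gamma_m(\theta))\in\mathfrak S_{m-1}$, where $\Gamma_m(\theta)(i)=\langle\theta(i)-\theta(1)+1\rangle_m$, and $\Psi_m(\eta)(i)=\eta(i+1)-1$ for $\eta\in\mathfrak S_m$ with $\eta(1)=1$ and $i\in[m-1]$. The children (under the lifting) of $\pi\in\mathcal V_{m-1}$ are the $\theta\in\mathcal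 V_m$ with $\Psi_m(\Gamma_m(\theta))=\pi$; $\pi$ is branching if it has two children, and non-branching otherwise. * $\mathfrak F_m$ is the set of open intervals between two successive terms of the $m$-th Farey sequence (the increasing sequence of all fractions in $[0,1]$ with denominator at most $m$). For $\theta\in\mathfrak S_m$, $\mathsf F_m[\theta]$ is the set of those $\alpha\in\bigcup\mathfrak F_m$ for which $\sigma=\theta^{-1}$ satisfies $0<\{\sigma(1)\alpha\}<\{\sigma(2)\alpha\}<\cdots<\{\sigma(m)\alpha\}<1$. Let $m\ge 2$. Then $\mathsf F_{m-1}$ restricts to a bijection $\mathcal V_{m-1}\to\mathfrak F_{m-1}$ and $\mathsf F_m$ to a bijection $\mathcal V_m\to\mathfrak F_m$, and for every $\pi\in\mathcal V_{m-1}$ the following holds. 1. If $\pi$ is non-branching, then $\pi$ has exactly one child $\hat\theta$, and $\mathsf F_m[\hat\theta]=\mathsf F_{m-1}[\pi]$. 2. If $\pi$ is branching, then there is $a\in[m]$ with $\gcd(a,m)=1$ (so that $a/m$ is a term of the $m$-th but not of the $(m-1)$-th Farey sequence) such that the set of children of $\pi$ is $\{\theta_{a,0},\theta_{a,1}\}$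 and $$\mathsf F_{m-1}[\pi]=\mathsf F_m[\theta_{a,0}]\sqcup\{a/m\}\sqcup\mathsf F_m[\theta_{a,1}],$$ a union of three pairwise disjoint sets. -/

import Mathlib

namespace SosLift

/-- The entry `θ(i)` of a permutation of `[m] = {1, …, m}` at `i ∈ [m]`. Permutations of `[m]` are
modelled by `Equiv.Perm (Fin m)`, where `k : Fin m` stands for the element `k + 1` of `[m]`.
(Outside `[m]` the value is `0` and is never used.) -/
def entry {m : ℕ} (θ : Equiv.Perm (Fin m)) (i : ℕ) : ℤ :=
  if h : 1 ≤ i ∧ i ≤ m then ((θ ⟨i - 1, by omega⟩ : Fin m) : ℤ) + 1 else 0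

/-- The representative in `{1, …, m}` of the class of `j` modulo `m`. -/
def smod (m : ℕ) (j : ℤ) : ℤ := (j - 1) % (m : ℤ) + 1

/-- The set `𝒱_m` of permutations `θ` of `[m]` with
`θ(i+1) - θ(i) ≡ θ(1) - 𝟙(θ(m) ≤ θ(i)) mod m` for all `i ∈ [m-1]`;
for `m = 1` it is the set of all permutations of `[1]`. -/
def V (m : ℕ) : Set (Equiv.Perm (Fin m)) :=
  {θ | ∀ i : ℕ, 1 ≤ i → i + 1 ≤ m →
    entry θ (i + 1) - entry θ i ≡
      entry θ 1 - (if entry θ m ≤ entry θ i then 1 else 0) [ZMOD m]}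

/-- The element of `Fin m` that stands for the element `smod m j` of `[m]`. -/
def cls {m : ℕ} (hm : 0 < m) (j : ℤ) : Fin m :=
  ⟨(smod m j - 1).toNat, by
    have h0 : (0 : ℤ) < m := by exact_mod_cast hm
    have h1 := Int.emod_nonneg (j - 1) h0.ne'
    have h2 := Int.emod_lt_of_pos (j - 1) h0
    unfold smod
    omega⟩

theorem cls_val {m : ℕ} (hm : 0 < m) (j : ℤ) : ((cls hm j : Fin m) : ℤ) + 1 = smod m j := by
  have h0 : (0 : ℤ) < m := by exact_mod_cast hm
  have h1 := Int.emod_nonneg (j - 1) h0.ne'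
  simp only [cls, smod]
  omega

theorem modEq_of_cls_eq {m : ℕ} (hm : 0 < m) {j j' : ℤ} (h : cls hm j = cls hm j') :
    j ≡ j' [ZMOD m] := by
  have h1 : smod m j = smod m j' := by rw [← cls_val hm, ← cls_val hm, h]
  have h2 : j - 1 ≡ j' - 1 [ZMOD m] := by
    unfold smod at h1
    unfold Int.ModEq
    omega
  simpa using h2.add_right 1

theorem fin_eq_of_modEq {m : ℕ} {k l : Fin m} (h : (k : ℤ) ≡ (l : ℤ) [ZMOD m]) : k = l := by
  have h1 : (k : ℕ) ≡ (l : ℕ) [MOD m] := Int.natCast_modEq_iff.mp h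
  exact Fin.ext (Nat.ModEq.eq_of_lt_of_lt h1 k.2 l.2)

/-- For `a` coprime to `m`, the permutation `θ_{a,b}` of `[m]` with
`θ_{a,b}(i) = smod m (a * i + b)`. -/
noncomputable def theta (m : ℕ) (a b : ℤ) (h : IsCoprime a (m : ℤ)) : Equiv.Perm (Fin m) :=
  Equiv.ofBijective (fun k : Fin m => cls k.pos (a * ((k : ℤ) + 1) + b)) <|
    Finite.injective_iff_bijective.mp fun k l hkl => by
      have h1 := (modEq_of_cls_eq k.pos hkl).add_right_cancel' b
      have h2 : ((m : ℤ)) ∣ a * (((l : ℤ) + 1) - ((k : ℤ) + 1)) := by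
        rw [mul_sub]; exact h1.dvd
      have h3 := h.symm.dvd_of_dvd_mul_left h2
      exact fin_eq_of_modEq (Int.modEq_iff_dvd.mpr (by simpa using h3))

/-- The shift `v ↦ smod m (v + k)` of the elements of `[m]`. -/
noncomputable def shift (m : ℕ) (k : ℤ) : Equiv.Perm (Fin m) :=
  Equiv.ofBijective (fun v : Fin m => cls v.pos (((v : ℤ) + 1) + k)) <|
    Finite.injective_iff_bijective.mp fun v w hvw => by
      have h1 := (modEq_of_cls_eq v.pos hvw).add_right_cancel' k
      exact fin_eq_of_modEq (h1.add_right_cancel' 1)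

/-- `Γ_m`: the permutation `i ↦ smod m (θ(i) - θ(1) + 1)`. -/
noncomputable def Gamma {m : ℕ} (θ : Equiv.Perm (Fin m)) : Equiv.Perm (Fin m) :=
  θ.trans (shift m (-entry θ 1 + 1))

/-- The set `𝔖_m^1` of permutations of `[m]` fixing `1`. -/
def S1 (m : ℕ) : Set (Equiv.Perm (Fin m)) := {θ | entry θ 1 = 1}

theorem entry_Gamma {m : ℕ} (θ : Equiv.Perm (Fin m)) (i : ℕ) (h1 : 1 ≤ i) (hi : i ≤ m) :
    entry (Gamma θ) i = smod m (entry θ i - entry θ 1 + 1) := by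
  have h : entry (Gamma θ) i = smod m (entry θ i + (-entry θ 1 + 1)) := by
    conv_lhs => rw [entry, dif_pos ⟨h1, hi⟩]
    conv_rhs => rw [entry, dif_pos ⟨h1, hi⟩]
    exact cls_val (by omega) _
  rw [h]
  congr 1
  ring

theorem Gamma_mem_S1 {m : ℕ} (hm : 1 ≤ m) (θ : Equiv.Perm (Fin m)) : Gamma θ ∈ S1 m := by
  change entry (Gamma θ) 1 = 1
  rw [entry_Gamma θ 1 le_rfl hm]
  simp [smod]

theorem S1_apply_eq_zero {m : ℕ} {θ : Equiv.Perm (Fin m)} (hθ : θ ∈ S1 m) (k : Fin m) :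
    ((θ k : Fin m) : ℕ) = 0 ↔ (k : ℕ) = 0 := by
  have hm : 0 < m := k.pos
  have h : (θ ⟨0, hm⟩ : Fin m) = ⟨0, hm⟩ := by
    have h1 : entry θ 1 = 1 := hθ
    rw [entry, dif_pos ⟨le_rfl, hm⟩] at h1
    apply Fin.ext
    have h2 : (⟨1 - 1, by omega⟩ : Fin m) = ⟨0, hm⟩ := rfl
    rw [h2] at h1
    have h3 : (((θ ⟨0, hm⟩ : Fin m) : ℕ) : ℤ) = 0 := by linarith
    exact_mod_cast h3
  constructor
  · intro hk
    have : θ k = θ ⟨0, hm⟩ := by rw [h]; exact Fin.ext hk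
    have := θ.injective this
    rw [this]
  · intro hk
    have : k = ⟨0, hm⟩ := Fin.ext hk
    rw [this, h]

/-- `Ψ_m : 𝔖_m^1 → 𝔖_{m-1}`, `Ψ_m(θ)(i) = θ(i+1) - 1` for `i ∈ [m-1]`. -/
noncomputable def Psi {m : ℕ} (θ : S1 m) : Equiv.Perm (Fin (m - 1)) :=
  Equiv.ofBijective
    (fun k : Fin (m - 1) =>
      (⟨((θ.1 ⟨(k : ℕ) + 1, by omega⟩ : Fin m) : ℕ) - 1, by
        have := (θ.1 ⟨(k : ℕ) + 1, by omega⟩ : Fin m).2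
        have := k.2
        omega⟩ : Fin (m - 1))) <|
    Finite.injective_iff_bijective.mp fun k l hkl => by
      have h1 := (S1_apply_eq_zero θ.2 ⟨(k : ℕ) + 1, by omega⟩).not.mpr (by simp)
      have h2 := (S1_apply_eq_zero θ.2 ⟨(l : ℕ) + 1, by omega⟩).not.mpr (by simp)
      have h3 := Fin.ext_iff.mp hkl
      simp only at h3
      have h4 : θ.1 ⟨(k : ℕ) + 1, by omega⟩ = θ.1 ⟨(l : ℕ) + 1, by omega⟩ :=
        Fin.ext (by omega)
      have h5 := Fin.ext_iff.mp (θ.1.injective h4)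
      simp only at h5
      exact Fin.ext (by omega)

/-- The children of a permutation `π` of `[m-1]` under the lifting: the permutations
`θ ∈ 𝒱_m` with `Ψ_m(Γ_m(θ)) = π`. -/
def children (m : ℕ) (hm : 1 ≤ m) (π : Equiv.Perm (Fin (m - 1))) : Set (Equiv.Perm (Fin m)) :=
  {θ | θ ∈ V m ∧ Psi ⟨Gamma θ, Gamma_mem_S1 hm θ⟩ = π}

/-- `π` is branching if it has two children. -/
def Branching (m : ℕ) (hm : 1 ≤ m) (π : Equiv.Perm (Fin (m - 1))) : Prop :=
  (children m hm π).ncard = 2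

/-- `0 < {σ(1)α} < {σ(2)α} < ⋯ < {σ(m)α}` (the bound `{σ(m)α} < 1` is automatic):
`σ` is the Sós permutation of degree `m` with parameter `α`. -/
def IsSos {m : ℕ} (α : ℝ) (σ : Equiv.Perm (Fin m)) : Prop :=
  0 < Int.fract ((entry σ 1 : ℝ) * α) ∧
    ∀ i : ℕ, 1 ≤ i → i + 1 ≤ m →
      Int.fract ((entry σ i : ℝ) * α) < Int.fract ((entry σ (i + 1) : ℝ) * α)

/-- The set of the terms of the Farey sequence of order `m`. -/
def farey (m : ℕ) : Set ℝ :=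
  {x | 0 ≤ x ∧ x ≤ 1 ∧ ∃ p q : ℕ, 1 ≤ q ∧ q ≤ m ∧ x = (p : ℝ) / (q : ℝ)}

/-- The set `𝔉_m` of open intervals between two successive terms of the Farey sequence of
order `m`. -/
def fareyIntervals (m : ℕ) : Set (Set ℝ) :=
  {F | ∃ x ∈ farey m, ∃ y ∈ farey m,
    x < y ∧ (∀ z ∈ farey m, ¬ (x < z ∧ z < y)) ∧ F = Set.Ioo x y}

/-- The set `F_m[θ]` of all `α` in a Farey interval of order `m` for which `θ` is the
inverse of the Sós permutation with parameter `α`. -/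
def F (m : ℕ) (θ : Equiv.Perm (Fin m)) : Set ℝ :=
  {α | α ∈ ⋃₀ fareyIntervals m ∧ IsSos α θ⁻¹}

end SosLift

/-! For `α` in `(0,1)` off the Farey sequence of order `m`, let `θ` rank the points `{α}, …, {mα}`;
then `θ⁻¹` is the Sós permutation of `α`. The ranking and the integer parts `⌊kα⌋`, `k ≤ m`,
determine each other, and these integer parts are constant exactly on Farey intervals. Hence `F`
sends each rank permutation to one Farey interval (`F_eq_of_mem`), and every interval arises in this
way. A floor-sum formula for the ranks puts rank permutations in `V` (`IsRank.mem_V`).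

The converse, that `V` holds nothing else, is an induction on `m`. Subtracting `α` rotates the
circle, so the projection of a rank permutation is the rank permutation of the same `α`
(`IsRank.proj`). A child is determined by its projection `π` and its first entry, which is `π(1)` or
`π(1) + 1` (`apply_zero_eq_of_mem_V`). If both occur, the children differ by the constant 1 modulo
`m`, and the recurrence forces them to be `θ_{a,0}` and `θ_{a,1}` (`eq_theta_of_proj_eq_of_lt`).
These rank the multiples of points just left and just right of `a/m`, so they too are rank
permutations.

The dichotomy follows. Off the Farey terms of order `m`, the interval of `π` is covered by the
intervals of its children. A new term `c/m` inside it makes both `θ_{c,0}` and `θ_{c,1}` children;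
conversely, two children put their `a/m` inside it. -/

namespace SosLift

/-! ### Rank permutations and Sós permutations -/

/-- `θ` ranks the fractional parts `{α}, {2α}, …, {mα}`, all of which are positive. -/
def IsRank {m : ℕ} (α : ℝ) (θ : Equiv.Perm (Fin m)) : Prop :=
  (∀ k : Fin m, 0 < Int.fract (((k : ℝ) + 1) * α)) ∧
    ∀ k l : Fin m, θ k ≤ θ l ↔ Int.fract (((k : ℝ) + 1) * α) ≤ Int.fract (((l : ℝ) + 1) * α)

theorem entry_succ {m : ℕ} (θ : Equiv.Perm (Fin m)) (k : Fin m) :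
    entry θ ((k : ℕ) + 1) = ((θ k : Fin m) : ℤ) + 1 := by
  have := k.2
  rw [entry, dif_pos ⟨by omega, by omega⟩]
  rfl

theorem isRank_of_lt {m : ℕ} {α : ℝ} {θ : Equiv.Perm (Fin m)}
    (h0 : ∀ k : Fin m, 0 < Int.fract (((k : ℝ) + 1) * α))
    (h : ∀ k l : Fin m, θ k < θ l →
      Int.fract (((k : ℝ) + 1) * α) < Int.fract (((l : ℝ) + 1) * α)) : IsRank α θ := by
  refine ⟨h0, fun k l => ⟨fun hkl => ?_, fun hkl => ?_⟩⟩
  · rcases hkl.lt_or_eq with h1 | h1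
    · exact (h k l h1).le
    · rw [θ.injective h1]
  · by_contra! h1
    exact absurd (h l k h1) (not_lt.mpr hkl)

theorem IsRank.lt_iff {m : ℕ} {α : ℝ} {θ : Equiv.Perm (Fin m)} (h : IsRank α θ) (k l : Fin m) :
    θ k < θ l ↔ Int.fract (((k : ℝ) + 1) * α) < Int.fract (((l : ℝ) + 1) * α) := by
  rw [← not_le, ← not_le, h.2]

theorem isSos_inv_iff {n : ℕ} {α : ℝ} {θ : Equiv.Perm (Fin (n + 1))} :
    IsSos α θ⁻¹ ↔ IsRank α θ := by
  have hentry : ∀ k : Fin (n + 1), ((entry θ⁻¹ ((k : ℕ) + 1) : ℤ) : ℝ) =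
      (((θ⁻¹ k : Fin (n + 1)) : ℕ) : ℝ) + 1 := fun k => by
    rw [entry_succ]; push_cast; rfl
  constructor
  · rintro ⟨h0, h⟩
    have hmono : StrictMono fun k : Fin (n + 1) =>
        Int.fract (((((θ⁻¹ k : Fin (n + 1)) : ℕ) : ℝ) + 1) * α) := by
      rw [Fin.strictMono_iff_lt_succ]
      intro i
      have hi := h ((i : ℕ) + 1) (by omega) (by omega)
      have e1 := hentry i.castSucc
      have e2 := hentry i.succ
      simp only [Fin.val_castSucc, Fin.val_succ] at e1 e2
      rwa [e1, e2] at hi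
    have e0 := hentry 0
    simp only [Fin.val_zero, zero_add] at e0
    rw [e0] at h0
    refine isRank_of_lt (fun k => ?_) fun k l hkl => ?_
    · have := hmono.monotone (Fin.zero_le (θ k))
      simp at this
      exact h0.trans_le this
    · simpa using hmono hkl
  · intro h
    refine ⟨?_, fun i hi hin => ?_⟩
    · have e0 := hentry 0
      simp only [Fin.val_zero, zero_add] at e0
      rw [e0]
      exact h.1 _
    · have e1 := hentry ⟨i - 1, by omega⟩
      have e2 := hentry ⟨i, by omega⟩
      simp only [Nat.sub_add_cancel hi] at e1 e2
      rw [e1, e2, ← h.lt_iff]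
      simp
      omega

/-- A rank counts the points not above a given one. This makes the permutation a function of `α`
alone. -/
theorem IsRank.apply_eq_sum {m : ℕ} {α : ℝ} {θ : Equiv.Perm (Fin m)} (h : IsRank α θ)
    (l : Fin m) : ((θ l : Fin m) : ℤ) + 1 =
      ∑ k : Fin m,
        if Int.fract (((k : ℝ) + 1) * α) ≤ Int.fract (((l : ℝ) + 1) * α) then (1 : ℤ) else 0 := by
  simp only [← h.2]
  rw [Equiv.sum_comp θ (fun x => if x ≤ θ l then (1 : ℤ) else 0), Finset.sum_boole,
    show (Finset.univ.filter fun x : Fin m => x ≤ θ l) = Finset.Iic (θ l) by ext; simp,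
    Fin.card_Iic]
  push_cast
  rfl

theorem IsRank.unique {m : ℕ} {α : ℝ} {θ θ' : Equiv.Perm (Fin m)} (h : IsRank α θ)
    (h' : IsRank α θ') : θ = θ' := by
  ext l
  have := h.apply_eq_sum l
  rw [← h'.apply_eq_sum l] at this
  omega

/-- The points of the unit interval outside the Farey sequence have a rank permutation. -/
theorem exists_isRank {m : ℕ} {α : ℝ} (h0 : 0 < α) (h1 : α < 1) (h : α ∉ farey m) :
    ∃ θ : Equiv.Perm (Fin m), IsRank α θ := by
  have key : ∀ q : ℕ, 1 ≤ q → q ≤ m → ∀ z : ℤ, (q : ℝ) * α ≠ z := by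
    intro q hq hqm z hz
    have hq' : (0 : ℝ) < q := by exact_mod_cast hq
    have hz0 : 0 ≤ z := by
      have : (0 : ℝ) < z := hz ▸ mul_pos hq' h0
      exact_mod_cast this.le
    refine h ⟨h0.le, h1.le, z.toNat, q, hq, hqm, ?_⟩
    have : ((z.toNat : ℕ) : ℝ) = (z : ℝ) := by exact_mod_cast Int.toNat_of_nonneg hz0
    rw [this, ← hz]
    field_simp
  let f : Fin m → ℝ := fun k => Int.fract (((k : ℝ) + 1) * α)
  have hf : Function.Injective f := by
    have aux : ∀ k l : Fin m, k < l → f k ≠ f l := by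
      intro k l hkl he
      obtain ⟨z, hz⟩ := Int.fract_eq_fract.mp he.symm
      have hkl' : (k : ℕ) < l := hkl
      refine key ((l : ℕ) - k) (by omega) (by omega) z ?_
      rw [Nat.cast_sub hkl'.le, ← hz]
      ring
    intro k l he
    rcases lt_trichotomy k l with hkl | hkl | hkl
    · exact absurd he (aux k l hkl)
    · exact hkl
    · exact absurd he.symm (aux l k hkl)
  have hmono : StrictMono (f ∘ Tuple.sort f) :=
    (Tuple.monotone_sort f).strictMono_of_injective (hf.comp (Tuple.sort f).injective)
  refine ⟨(Tuple.sort f)⁻¹, isRank_of_lt (fun k => ?_) fun k l hkl => ?_⟩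
  · refine lt_of_le_of_ne (Int.fract_nonneg _) fun he => ?_
    obtain ⟨z, hz⟩ := Int.fract_eq_zero_iff.mp he.symm
    refine key ((k : ℕ) + 1) (by omega) (by omega) z ?_
    push_cast
    exact hz.symm
  · simpa [f] using hmono hkl

theorem IsRank.notMem_farey {m : ℕ} {α : ℝ} {θ : Equiv.Perm (Fin m)} (h : IsRank α θ) :
    α ∉ farey m := by
  rintro ⟨-, -, p, q, hq, hqm, rfl⟩
  have := h.1 ⟨q - 1, by omega⟩
  have hq' : (q : ℝ) ≠ 0 := by positivity
  simp only [Nat.cast_sub hq, Nat.cast_one, sub_add_cancel] at this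
  rw [mul_div_cancel₀ _ hq', Int.fract_natCast] at this
  exact lt_irrefl _ this

/-! ### Farey terms and Farey intervals -/

theorem finite_farey (m : ℕ) : (farey m).Finite := by
  refine ((Set.finite_Iic m).prod (Set.finite_Iic m)).image
    (fun x : ℕ × ℕ => (x.1 : ℝ) / (x.2 : ℝ)) |>.subset ?_
  rintro x ⟨-, hx, p, q, hq, hqm, rfl⟩
  refine ⟨(p, q), ⟨?_, hqm⟩, rfl⟩
  have hq' : (0 : ℝ) < q := by exact_mod_cast hq
  rw [div_le_one hq'] at hx
  have : p ≤ q := by exact_mod_cast hx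
  exact this.trans hqm

theorem zero_mem_farey {m : ℕ} (hm : 1 ≤ m) : (0 : ℝ) ∈ farey m :=
  ⟨le_rfl, zero_le_one, 0, 1, le_rfl, hm, by simp⟩

theorem one_mem_farey {m : ℕ} (hm : 1 ≤ m) : (1 : ℝ) ∈ farey m :=
  ⟨zero_le_one, le_rfl, 1, 1, le_rfl, hm, by simp⟩

theorem exists_fareyInterval {m : ℕ} (hm : 1 ≤ m) {α : ℝ} (h0 : 0 < α) (h1 : α < 1)
    (h : α ∉ farey m) : ∃ I ∈ fareyIntervals m, α ∈ I := by
  obtain ⟨x, ⟨hx, hxα⟩, hx'⟩ := Set.exists_max_image (farey m ∩ Set.Iio α) id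
    ((finite_farey m).inter_of_left _) ⟨0, zero_mem_farey hm, h0⟩
  obtain ⟨y, ⟨hy, hyα⟩, hy'⟩ := Set.exists_min_image (farey m ∩ Set.Ioi α) id
    ((finite_farey m).inter_of_left _) ⟨1, one_mem_farey hm, h1⟩
  refine ⟨Set.Ioo x y, ⟨x, hx, y, hy, hxα.trans hyα, ?_, rfl⟩, hxα, hyα⟩
  rintro z hz ⟨hxz, hzy⟩
  rcases lt_trichotomy z α with hlt | rfl | hlt
  · exact absurd (hx' z ⟨hz, hlt⟩) (not_le.mpr hxz)
  · exact h hz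
  · exact absurd (hy' z ⟨hz, hlt⟩) (not_le.mpr hzy)

theorem mem_sUnion_fareyIntervals {m : ℕ} (hm : 1 ≤ m) {α : ℝ} :
    α ∈ ⋃₀ fareyIntervals m ↔ 0 < α ∧ α < 1 ∧ α ∉ farey m := by
  constructor
  · rintro ⟨_, ⟨x, hx, y, hy, -, hxy', rfl⟩, hα⟩
    exact ⟨hx.1.trans_lt hα.1, hα.2.trans_le hy.2.1, fun h => hxy' α h hα⟩
  · rintro ⟨h0, h1, h⟩
    exact exists_fareyInterval hm h0 h1 h

theorem mem_F_iff {n : ℕ} {θ : Equiv.Perm (Fin (n + 1))} {α : ℝ} :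
    α ∈ F (n + 1) θ ↔ 0 < α ∧ α < 1 ∧ IsRank α θ := by
  rw [F, Set.mem_ofPred_eq, mem_sUnion_fareyIntervals (by omega), isSos_inv_iff]
  exact ⟨fun h => ⟨h.1.1, h.1.2.1, h.2⟩, fun h => ⟨⟨h.1, h.2.1, h.2.2.notMem_farey⟩, h.2.2⟩⟩

/-! ### Integer parts of multiples and the ranking -/

theorem fract_le_fract_iff (x y : ℝ) :
    Int.fract x ≤ Int.fract y ↔ ⌊y - x⌋ = ⌊y⌋ - ⌊x⌋ := by
  rw [Int.floor_eq_iff]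
  have hx := Int.floor_add_fract x
  have hy := Int.floor_add_fract y
  have := Int.fract_nonneg x
  have := Int.fract_lt_one y
  push_cast
  constructor
  · intro h
    constructor <;> linarith
  · rintro ⟨h, -⟩
    linarith

theorem ite_fract_le_fract (x y : ℝ) :
    (if Int.fract x ≤ Int.fract y then (1 : ℤ) else 0) = 1 + ⌊y - x⌋ - ⌊y⌋ + ⌊x⌋ := by
  split_ifs with h
  · have := (fract_le_fract_iff x y).mp h
    omega
  · have : ⌊y - x⌋ = ⌊y⌋ - ⌊x⌋ - 1 := by
      rw [Int.floor_eq_iff]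
      have hx := Int.floor_add_fract x
      have hy := Int.floor_add_fract y
      have := Int.fract_nonneg y
      have := Int.fract_lt_one x
      push_cast
      constructor <;> linarith
    omega

theorem floor_neg_of_fract_pos {x : ℝ} (h : 0 < Int.fract x) : ⌊-x⌋ = -⌊x⌋ - 1 := by
  rw [Int.floor_eq_iff]
  have hx := Int.floor_add_fract x
  have := Int.fract_lt_one x
  push_cast
  constructor <;> linarith

/-- The rank permutation depends only on the integer parts of `α, 2α, …, mα`. -/
theorem IsRank.of_floor_eq {m : ℕ} {α β : ℝ} {θ : Equiv.Perm (Fin m)} (h : IsRank α θ)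
    (hβ : ∀ k : Fin m, 0 < Int.fract (((k : ℝ) + 1) * β))
    (hαβ : ∀ k : Fin m, ⌊((k : ℝ) + 1) * α⌋ = ⌊((k : ℝ) + 1) * β⌋) : IsRank β θ := by
  refine ⟨hβ, fun k l => ?_⟩
  -- The difference of two multiples is, up to sign, again one of the first `m` multiples, so its
  -- floor is known.
  have hdiff : ∀ k l : Fin m, k < l → ⌊((l : ℝ) + 1) * α - ((k : ℝ) + 1) * α⌋ =
      ⌊((l : ℝ) + 1) * β - ((k : ℝ) + 1) * β⌋ ∧ ⌊((k : ℝ) + 1) * α - ((l : ℝ) + 1) * α⌋ =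
      ⌊((k : ℝ) + 1) * β - ((l : ℝ) + 1) * β⌋ := by
    intro k l hkl
    have hkl' : (k : ℕ) < l := hkl
    let j : Fin m := ⟨(l : ℕ) - k - 1, by omega⟩
    have hj : ((j : ℕ) : ℝ) + 1 = (l : ℝ) - k := by
      have : (j : ℕ) + 1 + k = l := by simp only [j]; omega
      rw [← this]
      push_cast
      ring
    have e1 : ∀ γ : ℝ, ((l : ℝ) + 1) * γ - ((k : ℝ) + 1) * γ = ((j : ℝ) + 1) * γ := fun γ => by
      rw [hj]; ring
    have e2 : ∀ γ : ℝ, ((k : ℝ) + 1) * γ - ((l : ℝ) + 1) * γ = -(((j : ℝ) + 1) * γ) := fun γ => by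
      rw [hj]; ring
    rw [e1, e1, e2, e2, floor_neg_of_fract_pos (h.1 j), floor_neg_of_fract_pos (hβ j), hαβ j]
    exact ⟨rfl, rfl⟩
  rw [h.2, fract_le_fract_iff, fract_le_fract_iff, hαβ, hαβ]
  rcases lt_trichotomy k l with hkl | rfl | hkl
  · rw [(hdiff k l hkl).1]
  · simp
  · rw [(hdiff l k hkl).2]

/-- A step shorter than 1 raises the floor exactly when the fractional part wraps around. -/
theorem floor_add_eq {x α : ℝ} (h0 : 0 < α) (h1 : α < 1) :
    ⌊x + α⌋ = ⌊x⌋ + if Int.fract x ≤ Int.fract (x + α) then 0 else 1 := by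
  have h := ite_fract_le_fract x (x + α)
  have h2 : ⌊x + α - x⌋ = 0 := by
    rw [Int.floor_eq_iff]
    push_cast
    constructor <;> linarith
  rw [h2] at h
  split_ifs at h ⊢ <;> omega

/-- The rank permutation determines the integer parts of `α, 2α, …, mα`. -/
theorem IsRank.floor_eq {n : ℕ} {α β : ℝ} {θ : Equiv.Perm (Fin (n + 1))} (h : IsRank α θ)
    (h' : IsRank β θ) (hα0 : 0 < α) (hα1 : α < 1) (hβ0 : 0 < β) (hβ1 : β < 1)
    (k : Fin (n + 1)) : ⌊((k : ℝ) + 1) * α⌋ = ⌊((k : ℝ) + 1) * β⌋ := by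
  induction k using Fin.induction with
  | zero =>
    simp only [Fin.val_zero, Nat.cast_zero, zero_add, one_mul]
    rw [Int.floor_eq_zero_iff.mpr ⟨hα0.le, hα1⟩, Int.floor_eq_zero_iff.mpr ⟨hβ0.le, hβ1⟩]
  | succ i ih =>
    have e : ∀ γ : ℝ, (((i.succ : Fin (n + 1)) : ℝ) + 1) * γ =
        ((i.castSucc : Fin (n + 1)) + 1) * γ + γ := fun γ => by
      simp only [Fin.val_succ, Fin.val_castSucc]; push_cast; ring
    have hα := h.2 i.castSucc i.succ
    have hβ := h'.2 i.castSucc i.succ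
    rw [e α] at hα
    rw [e β] at hβ
    rw [e α, e β, floor_add_eq hα0 hα1, floor_add_eq hβ0 hβ1, ih]
    simp only [← hα, ← hβ]

/-- If the floor rose to `z` between two points, the Farey term `z / (k + 1)` would lie inside the
interval. -/
theorem floor_eq_of_mem_fareyInterval {m : ℕ} {I : Set ℝ} (hI : I ∈ fareyIntervals m) {α β : ℝ}
    (hα : α ∈ I) (hβ : β ∈ I) (k : Fin m) : ⌊((k : ℝ) + 1) * α⌋ = ⌊((k : ℝ) + 1) * β⌋ := by
  obtain ⟨x, hx, y, hy, -, hxy', rfl⟩ := hI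
  have aux : ∀ γ δ : ℝ, γ ∈ Set.Ioo x y → δ ∈ Set.Ioo x y →
      ⌊((k : ℝ) + 1) * δ⌋ ≤ ⌊((k : ℝ) + 1) * γ⌋ := by
    intro γ δ hγ hδ
    by_contra! hlt
    have hk : (0 : ℝ) < (k : ℝ) + 1 := by positivity
    have h1 : ((k : ℝ) + 1) * γ < ⌊((k : ℝ) + 1) * δ⌋ := Int.floor_lt.mp hlt
    have h2 := Int.floor_le (((k : ℝ) + 1) * δ)
    generalize ⌊((k : ℝ) + 1) * δ⌋ = z at h1 h2
    have h3 : γ < z / ((k : ℝ) + 1) := by rw [lt_div_iff₀ hk]; linarith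
    have h4 : z / ((k : ℝ) + 1) ≤ δ := by rw [div_le_iff₀ hk]; linarith
    have hγ0 : 0 < γ := hx.1.trans_lt hγ.1
    have hz : 0 ≤ z := by
      have : (0 : ℝ) < z := (mul_pos hk hγ0).trans h1
      exact_mod_cast this.le
    refine hxy' (z / ((k : ℝ) + 1)) ⟨?_, ?_, z.toNat, (k : ℕ) + 1, by omega, by omega, ?_⟩
      ⟨hγ.1.trans h3, h4.trans_lt hδ.2⟩
    · exact (hγ0.trans h3).le
    · exact (h4.trans hδ.2.le).trans hy.2.1
    · have : ((z.toNat : ℕ) : ℝ) = (z : ℝ) := by exact_mod_cast Int.toNat_of_nonneg hz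
      rw [this]
      push_cast
      rfl
  exact le_antisymm (aux β α hβ hα) (aux α β hα hβ)

/-- Floors record the position relative to every Farey term, as `p / q ≤ α` means `p ≤ ⌊qα⌋`. -/
theorem mem_fareyInterval_of_floor_eq {m : ℕ} {I : Set ℝ} (hI : I ∈ fareyIntervals m) {α β : ℝ}
    (hα : α ∈ I) (hβ : β ∉ farey m)
    (h : ∀ k : Fin m, ⌊((k : ℝ) + 1) * α⌋ = ⌊((k : ℝ) + 1) * β⌋) : β ∈ I := by
  obtain ⟨x, hx, y, hy, -, hxy', rfl⟩ := hI
  have aux : ∀ p q : ℕ, 1 ≤ q → q ≤ m → ((p : ℝ) / q ≤ α ↔ (p : ℝ) / q ≤ β) := by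
    intro p q hq hqm
    have hq' : (0 : ℝ) < q := by exact_mod_cast hq
    have hk := h ⟨q - 1, by omega⟩
    simp only [Nat.cast_sub hq, Nat.cast_one, sub_add_cancel] at hk
    rw [div_le_iff₀' hq', div_le_iff₀' hq', ← Int.cast_natCast p, ← Int.le_floor,
      ← Int.le_floor, hk]
  constructor
  · obtain ⟨-, -, p, q, hq, hqm, rfl⟩ := id hx
    exact lt_of_le_of_ne ((aux p q hq hqm).mp hα.1.le) fun he => hβ (he ▸ hx)
  · obtain ⟨-, -, p, q, hq, hqm, rfl⟩ := id hy
    exact not_le.mp fun hle => absurd ((aux p q hq hqm).mpr hle) (not_le.mpr hα.2)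

theorem fract_pos_of_notMem_farey {m : ℕ} {α : ℝ} (h0 : 0 < α) (h1 : α < 1) (h : α ∉ farey m)
    (k : Fin m) : 0 < Int.fract (((k : ℝ) + 1) * α) := by
  obtain ⟨θ, hθ⟩ := exists_isRank h0 h1 h
  exact hθ.1 k

theorem F_eq_of_mem {n : ℕ} {I : Set ℝ} (hI : I ∈ fareyIntervals (n + 1)) {α : ℝ} (hα : α ∈ I)
    {θ : Equiv.Perm (Fin (n + 1))} (hθ : IsRank α θ) : F (n + 1) θ = I := by
  have hmem : ∀ β ∈ I, 0 < β ∧ β < 1 ∧ β ∉ farey (n + 1) := fun β hβ =>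
    (mem_sUnion_fareyIntervals (by omega)).mp ⟨I, hI, hβ⟩
  obtain ⟨hα0, hα1, -⟩ := hmem α hα
  ext β
  rw [mem_F_iff]
  constructor
  · rintro ⟨h0, h1, h⟩
    exact mem_fareyInterval_of_floor_eq hI hα h.notMem_farey
      (hθ.floor_eq h hα0 hα1 h0 h1)
  · intro hβ
    obtain ⟨h0, h1, h⟩ := hmem β hβ
    exact ⟨h0, h1, hθ.of_floor_eq (fract_pos_of_notMem_farey h0 h1 h)
      (floor_eq_of_mem_fareyInterval hI hα hβ)⟩

/-! ### Rank permutations satisfy the recurrence -/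

theorem mem_V_succ_iff {n : ℕ} {θ : Equiv.Perm (Fin (n + 1))} :
    θ ∈ V (n + 1) ↔ ∀ k : Fin n, ((θ k.succ : Fin (n + 1)) : ℤ) - (θ k.castSucc : Fin (n + 1)) ≡
      (θ 0 : Fin (n + 1)) + 1 - (if θ (Fin.last n) ≤ θ k.castSucc then 1 else 0)
        [ZMOD ((n + 1 : ℕ) : ℤ)] := by
  have key : ∀ k : Fin n, (entry θ ((k : ℕ) + 1 + 1) - entry θ ((k : ℕ) + 1) ≡
      entry θ 1 - (if entry θ (n + 1) ≤ entry θ ((k : ℕ) + 1) then 1 else 0)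
        [ZMOD ((n + 1 : ℕ) : ℤ)]) ↔
      (((θ k.succ : Fin (n + 1)) : ℤ) - (θ k.castSucc : Fin (n + 1)) ≡
      (θ 0 : Fin (n + 1)) + 1 - (if θ (Fin.last n) ≤ θ k.castSucc then 1 else 0)
        [ZMOD ((n + 1 : ℕ) : ℤ)]) := by
    intro k
    have e1 := entry_succ θ k.castSucc
    have e2 := entry_succ θ k.succ
    have e3 := entry_succ θ (Fin.last n)
    have e4 := entry_succ θ 0
    simp only [Fin.val_castSucc, Fin.val_succ, Fin.val_last, Fin.val_zero, zero_add]
      at e1 e2 e3 e4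
    rw [e1, e2, e3, e4, add_sub_add_right_eq_sub]
    simp only [add_le_add_iff_right, Fin.le_def, Nat.cast_le]
  constructor
  · intro h k
    exact (key k).mp (h ((k : ℕ) + 1) (by omega) (by omega))
  · intro h i hi hin
    have := (key ⟨i - 1, by omega⟩).mpr (h _)
    simpa only [Nat.sub_add_cancel hi] using this

theorem sum_floor_sub_telescope (m : ℕ) (α : ℝ) (l : ℕ) :
    ∑ k ∈ Finset.range m, ⌊((l : ℝ) + 1 - k) * α⌋ - ∑ k ∈ Finset.range m, ⌊((l : ℝ) - k) * α⌋ =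
      ⌊((l : ℝ) + 1) * α⌋ - ⌊((l : ℝ) + 1 - m) * α⌋ := by
  induction m with
  | zero => simp
  | succ m ih =>
    rw [Finset.sum_range_succ, Finset.sum_range_succ, Nat.cast_succ,
      show (l : ℝ) + 1 - ((m : ℝ) + 1) = l - m by ring]
    linarith

/-- Opposite terms pair as `⌊x⌋ + ⌊-x⌋ = -1`, leaving the top term unpaired. -/
theorem sum_floor_add_sum_floor_neg {m n : ℕ} (α : ℝ) (hn : n ≤ m)
    (h : ∀ k : Fin m, 0 < Int.fract (((k : ℝ) + 1) * α)) :
    ∑ k ∈ Finset.range (n + 1), ⌊((k : ℝ) + 1) * α⌋ +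
      ∑ k ∈ Finset.range (n + 1), ⌊((0 : ℝ) - k) * α⌋ = ⌊((n : ℝ) + 1) * α⌋ - n := by
  induction n with
  | zero => simp
  | succ n ih =>
    have ih := ih (by omega)
    rw [Finset.sum_range_succ, Finset.sum_range_succ _ (n + 1)]
    have := floor_neg_of_fract_pos (h ⟨n, by omega⟩)
    have e : ((0 : ℝ) - ((n + 1 : ℕ) : ℝ)) * α = -(((n : ℝ) + 1) * α) := by push_cast; ring
    simp only at this
    rw [e, this]
    push_cast at *
    linarith

/-- Each comparison in the counting sum is written as a combination of floors, so that consecutive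
ranks differ by a telescoping sum. -/
theorem IsRank.apply_eq_floor {m : ℕ} {α : ℝ} {θ : Equiv.Perm (Fin m)} (h : IsRank α θ)
    (l : Fin m) : ((θ l : Fin m) : ℤ) + 1 =
      m * (1 - ⌊((l : ℝ) + 1) * α⌋) + ∑ k ∈ Finset.range m, ⌊((k : ℝ) + 1) * α⌋ +
        ∑ k ∈ Finset.range m, ⌊((l : ℝ) - k) * α⌋ := by
  rw [h.apply_eq_sum, Finset.sum_range, Finset.sum_range]
  simp only [ite_fract_le_fract, Finset.sum_add_distrib, Finset.sum_sub_distrib, Finset.sum_const,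
    Finset.card_univ, Fintype.card_fin, nsmul_eq_mul]
  have : ∀ k : Fin m, ((l : ℝ) + 1) * α - ((k : ℝ) + 1) * α = ((l : ℝ) - k) * α := fun k => by ring
  simp only [this]
  ring

theorem IsRank.mem_V {n : ℕ} {α : ℝ} {θ : Equiv.Perm (Fin (n + 1))} (h : IsRank α θ) :
    θ ∈ V (n + 1) := by
  rw [mem_V_succ_iff]
  intro k
  have e0 := h.apply_eq_floor 0
  have e1 := h.apply_eq_floor k.castSucc
  have e2 := h.apply_eq_floor k.succ
  have t0 := sum_floor_add_sum_floor_neg (n := n) α (by omega) h.1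
  have t1 := sum_floor_sub_telescope (n + 1) α k
  have hε := ite_fract_le_fract (((n : ℝ) + 1) * α) (((k : ℝ) + 1) * α)
  have hle := h.2 (Fin.last n) k.castSucc
  simp only [Fin.val_last, Fin.val_castSucc] at hle
  simp only [← hle] at hε
  rw [hε]
  simp only [Fin.val_zero, Fin.val_castSucc, Fin.val_succ, Nat.cast_zero, Nat.cast_succ,
    zero_add, one_mul] at e0 e1 e2 t0 t1
  rw [show ((k : ℝ) + 1) * α - ((n : ℝ) + 1) * α = ((k : ℝ) + 1 - (n + 1)) * α by ring]
  rw [Int.modEq_iff_dvd]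
  -- The quotient collects the multiples of `n + 1` in the three rank formulas. The final `-1` comes
  -- from `-n` in `t0` together with the constant 1 in the indicator.
  refine ⟨⌊((k : ℝ) + 1 + 1) * α⌋ - ⌊((k : ℝ) + 1) * α⌋ + (1 - ⌊α⌋) - 1, ?_⟩
  push_cast
  linear_combination e0 + e1 - e2 + t0 - t1

/-! ### The projection -/

/-- The projection `Ψ_m ∘ Γ_m`. -/
noncomputable def proj {n : ℕ} (θ : Equiv.Perm (Fin (n + 1))) : Equiv.Perm (Fin n) :=
  Psi ⟨Gamma θ, Gamma_mem_S1 (by omega) θ⟩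

theorem proj_apply {n : ℕ} (θ : Equiv.Perm (Fin (n + 1))) (k : Fin n) :
    ((proj θ k : Fin n) : ℤ) + 1 =
      if θ 0 < θ k.succ then ((θ k.succ : Fin (n + 1)) : ℤ) - (θ 0 : Fin (n + 1))
      else ((θ k.succ : Fin (n + 1)) : ℤ) - (θ 0 : Fin (n + 1)) + (n + 1) := by
  have h1 := entry_Gamma θ ((k.succ : ℕ) + 1) (by omega) (by omega)
  have h2 := entry_succ θ 0
  simp only [Fin.val_zero, zero_add] at h2
  rw [entry_succ, entry_succ, h2, smod] at h1
  have hne : θ k.succ ≠ θ 0 := θ.injective.ne (Fin.succ_ne_zero k)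
  have hne' : ((θ k.succ : Fin (n + 1)) : ℕ) ≠ (θ 0 : Fin (n + 1)) := fun h => hne (Fin.ext h)
  have h3 : ((proj θ k : Fin n) : ℕ) = ((Gamma θ k.succ : Fin (n + 1)) : ℕ) - 1 := rfl
  have b1 := (θ k.succ).2
  have b2 := (θ 0).2
  simp only [Fin.lt_def]
  split_ifs with hlt
  · rw [Int.emod_eq_of_lt (by omega) (by push_cast; omega)] at h1
    omega
  · rw [← Int.add_emod_right, Int.emod_eq_of_lt (by push_cast; omega) (by push_cast; omega)] at h1
    push_cast at h1
    omega

theorem proj_ext {n : ℕ} {θ θ' : Equiv.Perm (Fin (n + 1))} (h : proj θ = proj θ')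
    (h0 : θ 0 = θ' 0) : θ = θ' := by
  ext k
  cases k using Fin.cases with
  | zero => rw [h0]
  | succ k =>
    have h1 := proj_apply θ k
    have h2 := proj_apply θ' k
    rw [h, h0] at h1
    rw [h1] at h2
    have := (θ k.succ).2
    have := (θ' k.succ).2
    simp only [Fin.lt_def] at h2
    split_ifs at h2 <;> omega

theorem fract_sub_eq (x y : ℝ) : Int.fract (x - y) =
    if Int.fract y ≤ Int.fract x then Int.fract x - Int.fract y
    else Int.fract x - Int.fract y + 1 := by
  have := Int.fract_nonneg x
  have := Int.fract_lt_one x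
  have := Int.fract_nonneg y
  have := Int.fract_lt_one y
  have hx := Int.floor_add_fract x
  have hy := Int.floor_add_fract y
  rw [Int.fract_eq_iff]
  split_ifs with h
  · exact ⟨by linarith, by linarith, ⌊x⌋ - ⌊y⌋, by push_cast; linarith⟩
  · exact ⟨by linarith, by linarith, ⌊x⌋ - ⌊y⌋ - 1, by push_cast; linarith⟩

/-- Subtracting `α` turns the multiples from `2α` on into those from `α` on. It rotates the
fractional parts just as the projection rotates the ranks. -/
theorem IsRank.proj {n : ℕ} {α : ℝ} {θ : Equiv.Perm (Fin (n + 1))} (h : IsRank α θ) :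
    IsRank α (proj θ) := by
  have hf : ∀ k : Fin n, Int.fract (((k : ℝ) + 1) * α) =
      if θ 0 ≤ θ k.succ
      then Int.fract ((((k.succ : Fin (n + 1)) : ℝ) + 1) * α) -
        Int.fract ((((0 : Fin (n + 1)) : ℝ) + 1) * α)
      else Int.fract ((((k.succ : Fin (n + 1)) : ℝ) + 1) * α) -
        Int.fract ((((0 : Fin (n + 1)) : ℝ) + 1) * α) + 1 := by
    intro k
    simp only [h.2]
    rw [← fract_sub_eq]
    congr 1
    simp only [Fin.val_succ, Fin.val_zero]
    push_cast
    ring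
  refine isRank_of_lt (fun k => ?_) fun k l hkl => ?_
  · have := h.1 k.castSucc
    simpa using this
  · rw [hf k, hf l]
    have hk := proj_apply θ k
    have hl := proj_apply θ l
    have hkl' : (SosLift.proj θ k : ℕ) < SosLift.proj θ l := hkl
    have hk0 : θ k.succ ≠ θ 0 := θ.injective.ne (Fin.succ_ne_zero k)
    have hl0 : θ l.succ ≠ θ 0 := θ.injective.ne (Fin.succ_ne_zero l)
    have c1 := h.lt_iff k.succ l.succ
    have c2 := h.lt_iff l.succ 0
    have c3 := h.lt_iff 0 k.succ
    have := Int.fract_lt_one ((((k.succ : Fin (n + 1)) : ℝ) + 1) * α)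
    have := Int.fract_nonneg ((((l.succ : Fin (n + 1)) : ℝ) + 1) * α)
    simp only [Fin.lt_def, Fin.le_def, ne_eq, Fin.ext_iff] at *
    split_ifs with h1 h2 h2
    · have := c1.mp (by split_ifs at hk hl <;> omega)
      linarith
    · linarith
    · split_ifs at hk hl <;> omega
    · have := c1.mp (by split_ifs at hk hl <;> omega)
      linarith

theorem eq_zero_or_neg_of_dvd {M x : ℤ} (h : M ∣ x) (h1 : -(2 * M) < x) (h2 : x < M) :
    x = 0 ∨ x = -M := by
  obtain ⟨c, rfl⟩ := h
  have hM : 0 < M := by linarith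
  have : c < 1 := by nlinarith
  have : -2 < c := by nlinarith
  obtain rfl | rfl : c = 0 ∨ c = -1 := by omega
  · simp
  · right; ring

/-- Size bounds leave two possible values for the defect of the congruence, which makes the
recurrence accessible to linear arithmetic. -/
theorem succ_sub_eq_of_mem_V {n : ℕ} {θ : Equiv.Perm (Fin (n + 1))} (hθ : θ ∈ V (n + 1))
    (k : Fin n) {d : ℤ} (hd : d = ((θ k.succ : Fin (n + 1)) : ℤ) - (θ k.castSucc : Fin (n + 1)) -
      ((θ 0 : Fin (n + 1)) + 1 - (if θ (Fin.last n) ≤ θ k.castSucc then 1 else 0))) :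
    d = 0 ∨ d = -((n : ℤ) + 1) := by
  have h := (mem_V_succ_iff.mp hθ k).symm.dvd
  rw [← hd] at h
  have := (θ k.succ).2
  have := (θ k.castSucc).2
  have := (θ 0).2
  have := eq_zero_or_neg_of_dvd h (by split_ifs at hd <;> push_cast <;> omega)
    (by split_ifs at hd <;> push_cast <;> omega)
  push_cast at this
  exact this

theorem proj_mem_V {n : ℕ} {θ : Equiv.Perm (Fin (n + 2))} (hθ : θ ∈ V (n + 2)) :
    proj θ ∈ V (n + 1) := by
  rw [mem_V_succ_iff]
  intro k
  have hC := succ_sub_eq_of_mem_V hθ 0 rfl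
  have hB := succ_sub_eq_of_mem_V hθ k.succ rfl
  have p0 := proj_apply θ 0
  have p1 := proj_apply θ k.castSucc
  have p2 := proj_apply θ k.succ
  have p3 := proj_apply θ (Fin.last n)
  have i1 : θ k.succ.succ ≠ θ k.succ.castSucc :=
    θ.injective.ne (by simp [Fin.ext_iff])
  have i2 : θ k.succ.succ ≠ θ 0 := θ.injective.ne (Fin.succ_ne_zero _)
  have i3 : θ k.castSucc.succ ≠ θ 0 := θ.injective.ne (Fin.succ_ne_zero _)
  have i4 : θ (Fin.last n).succ ≠ θ 0 := θ.injective.ne (Fin.succ_ne_zero _)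
  have i5 : θ (0 : Fin (n + 1)).succ ≠ θ 0 := θ.injective.ne (Fin.succ_ne_zero _)
  rw [← Fin.succ_castSucc] at *
  rw [Fin.succ_last] at *
  rw [Fin.castSucc_zero] at *
  have b1 := (θ k.succ.succ).2
  have b2 := (θ k.castSucc.succ).2
  have b3 := (θ (Fin.last (n + 1))).2
  have b4 := (θ 0).2
  have b5 := (θ (0 : Fin (n + 1)).succ).2
  rw [Int.modEq_iff_dvd]
  -- Entries are bounded, so the divisibility amounts to a finite disjunction, settled by cases from
  -- the recurrence of `θ` at its first step and at the step following `k`.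
  suffices h : ∀ x : ℤ, x = 0 ∨ x = (n + 1 : ℕ) ∨ x = -(n + 1 : ℕ) → ((n + 1 : ℕ) : ℤ) ∣ x by
    apply h
    simp only [Fin.lt_def, Fin.le_def, ne_eq, Fin.ext_iff] at *
    generalize ((θ k.succ.succ : Fin (n + 2)) : ℕ) = B at *
    generalize ((θ k.castSucc.succ : Fin (n + 2)) : ℕ) = A at *
    generalize ((θ (Fin.last (n + 1)) : Fin (n + 2)) : ℕ) = L at *
    generalize ((θ 0 : Fin (n + 2)) : ℕ) = T at *
    generalize ((θ (0 : Fin (n + 1)).succ : Fin (n + 2)) : ℕ) = C at *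
    generalize ((proj θ 0 : Fin (n + 1)) : ℕ) = P0 at *
    generalize ((proj θ k.castSucc : Fin (n + 1)) : ℕ) = P1 at *
    generalize ((proj θ k.succ : Fin (n + 1)) : ℕ) = P2 at *
    generalize ((proj θ (Fin.last n) : Fin (n + 1)) : ℕ) = P3 at *
    push_cast at *
    split_ifs at * <;> omega
  rintro x (rfl | rfl | rfl)
  exacts [dvd_zero _, dvd_rfl, (dvd_neg).mpr dvd_rfl]

/-! ### The permutations `θ_{a,b}` near `a/m` -/

theorem theta_apply {m : ℕ} {a b : ℤ} (h : IsCoprime a (m : ℤ)) (k : Fin m) :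
    ((theta m a b h k : Fin m) : ℤ) + 1 = smod m (a * ((k : ℤ) + 1) + b) :=
  cls_val k.pos _

theorem dvd_theta_sub {m : ℕ} {a b : ℤ} (h : IsCoprime a (m : ℤ)) (k : Fin m) :
    (m : ℤ) ∣ ((theta m a b h k : Fin m) : ℤ) + 1 - (a * ((k : ℤ) + 1) + b) := by
  rw [theta_apply, smod]
  obtain ⟨c, hc⟩ := Int.dvd_sub_self_of_emod_eq (a := a * ((k : ℤ) + 1) + b - 1) (b := m) rfl
  exact ⟨c, by linear_combination hc⟩

theorem eq_theta {m : ℕ} {a b : ℤ} (h : IsCoprime a (m : ℤ)) {θ : Equiv.Perm (Fin m)}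
    (hθ : ∀ k : Fin m, (m : ℤ) ∣ ((θ k : Fin m) : ℤ) + 1 - (a * ((k : ℤ) + 1) + b)) :
    θ = theta m a b h := by
  ext k
  refine congrArg Fin.val (fin_eq_of_modEq (Int.modEq_iff_dvd.mpr ?_))
  obtain ⟨c, hc⟩ := dvd_sub (dvd_theta_sub (b := b) h k) (hθ k)
  exact ⟨c, by linear_combination hc⟩

/-- The value at the last index is congruent to `b`, whatever `a` is. -/
theorem eq_of_theta_eq_theta {n : ℕ} {a c b d : ℤ} {ha : IsCoprime a ((n + 1 : ℕ) : ℤ)}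
    {hc : IsCoprime c ((n + 1 : ℕ) : ℤ)} (h : theta (n + 1) a b ha = theta (n + 1) c d hc) :
    ((n + 1 : ℕ) : ℤ) ∣ b - d := by
  have h1 := dvd_theta_sub (b := b) ha (Fin.last n)
  have h2 := dvd_theta_sub (b := d) hc (Fin.last n)
  rw [h] at h1
  obtain ⟨e, he⟩ := dvd_sub h2 h1
  refine ⟨e + c - a, ?_⟩
  simp only [Fin.val_last] at he
  push_cast at he ⊢
  linear_combination he

theorem theta_zero_ne_theta_one {n : ℕ} {a c : ℤ} (ha : IsCoprime a ((n + 2 : ℕ) : ℤ))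
    (hc : IsCoprime c ((n + 2 : ℕ) : ℤ)) : theta (n + 2) a 0 ha ≠ theta (n + 2) c 1 hc := by
  intro h
  have h1 := eq_of_theta_eq_theta h
  have := Int.le_of_dvd one_pos ((dvd_neg).mpr h1)
  push_cast at this
  omega

/-- Near `a / m` the permutations `θ_{a,0}` and `θ_{a,1}` are rank permutations. -/
theorem isRank_theta {m : ℕ} {a b : ℤ} (h : IsCoprime a (m : ℤ)) {s : ℝ}
    (hs : ∀ k : Fin m, 0 < (1 - b) / (m : ℝ) + ((k : ℝ) + 1) * s ∧
      (1 - b) / (m : ℝ) + ((k : ℝ) + 1) * s < 1 / m) : IsRank (a / m + s) (theta m a b h) := by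
  -- Each rank gets its own cell of length `1/m`; by `hs` the offset stays inside the cell.
  have hf : ∀ k : Fin m, Int.fract (((k : ℝ) + 1) * (a / m + s)) =
      ((theta m a b h k : Fin m) : ℝ) / m + ((1 - b) / (m : ℝ) + ((k : ℝ) + 1) * s) := by
    intro k
    have hm : (0 : ℝ) < m := by exact_mod_cast k.pos
    obtain ⟨z, hz⟩ := dvd_theta_sub (b := b) h k
    have hz' : ((theta m a b h k : Fin m) : ℝ) + 1 - (a * ((k : ℝ) + 1) + b) = m * z := by
      exact_mod_cast hz
    have hlt : ((theta m a b h k : Fin m) : ℝ) + 1 ≤ m := by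
      exact_mod_cast (theta m a b h k).2
    rw [Int.fract_eq_iff]
    refine ⟨add_nonneg (by positivity) (hs k).1.le, ?_, -z, ?_⟩
    · have h1 : ((theta m a b h k : Fin m) : ℝ) / m + 1 / m ≤ 1 := by
        rw [← add_div, div_le_one hm]; exact hlt
      linarith [(hs k).2]
    · push_cast
      field_simp
      linarith
  refine isRank_of_lt (fun k => ?_) fun k l hkl => ?_
  · rw [hf]
    exact add_pos_of_nonneg_of_pos (by positivity) (hs k).1
  · rw [hf, hf]
    have hm : (0 : ℝ) < m := by exact_mod_cast k.pos
    have hlt : ((theta m a b h k : Fin m) : ℝ) + 1 ≤ (theta m a b h l : Fin m) := by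
      exact_mod_cast hkl
    have h1 : ((theta m a b h k : Fin m) : ℝ) / m + 1 / m ≤ (theta m a b h l : Fin m) / m := by
      rw [← add_div]
      gcongr
    linarith [(hs k).2, (hs l).1]

theorem exists_isRank_theta {m : ℕ} (hm : 0 < m) {a b : ℤ} (h : IsCoprime a (m : ℤ))
    (hb : b = 0 ∨ b = 1) {x y : ℝ} (hx : x < a / m) (hy : a / m < y) :
    ∃ α ∈ Set.Ioo x y, IsRank α (theta m a b h) := by
  have hm' : (0 : ℝ) < m := by exact_mod_cast hm
  -- The bound `δ < 1/m²` keeps all offsets `(k + 1)δ` below `1/m`. The point is taken left of `a/m`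
  -- for `b = 0` and right of it for `b = 1`.
  obtain ⟨δ, hδ0, hδ⟩ := exists_between
    (lt_min (lt_min (sub_pos.mpr hx) (sub_pos.mpr hy)) (show (0 : ℝ) < 1 / m / m by positivity))
  rw [lt_min_iff, lt_min_iff, lt_div_iff₀ hm'] at hδ
  obtain ⟨⟨hδx, hδy⟩, hδm⟩ := hδ
  have hk : ∀ k : Fin m, 0 < ((k : ℝ) + 1) * δ ∧ ((k : ℝ) + 1) * δ < 1 / m := by
    intro k
    have : (k : ℝ) + 1 ≤ m := by exact_mod_cast k.2
    refine ⟨by positivity, lt_of_le_of_lt ?_ hδm⟩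
    rw [mul_comm]
    gcongr
  rcases hb with rfl | rfl
  · refine ⟨a / m + -δ, ⟨by linarith, by linarith⟩, isRank_theta h fun k => ?_⟩
    have := hk k
    push_cast
    rw [sub_zero, mul_neg]
    constructor <;> linarith
  · refine ⟨a / m + δ, ⟨by linarith, by linarith⟩, isRank_theta h fun k => ?_⟩
    simpa using hk k

/-! ### Classification of children -/

/-- Modulo `m`, the first entry of the projection is `θ(2) - θ(1)`, which the recurrence at `i = 1`
evaluates. So only two first entries are possible for given `π`. -/
theorem apply_zero_eq_of_mem_V {n : ℕ} {θ : Equiv.Perm (Fin (n + 2))} (hθ : θ ∈ V (n + 2)) :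
    ((θ 0 : Fin (n + 2)) : ℤ) =
      (proj θ 0 : Fin (n + 1)) + if θ (Fin.last (n + 1)) ≤ θ 0 then 1 else 0 := by
  have hC := succ_sub_eq_of_mem_V hθ 0 rfl
  have p0 := proj_apply θ 0
  have hne : θ (0 : Fin (n + 1)).succ ≠ θ 0 := θ.injective.ne (Fin.succ_ne_zero _)
  rw [Fin.castSucc_zero] at hC
  have b5 := (θ (0 : Fin (n + 1)).succ).2
  have b4 := (θ 0).2
  simp only [Fin.lt_def, Fin.le_def, ne_eq, Fin.ext_iff] at *
  generalize ((θ (0 : Fin (n + 1)).succ : Fin (n + 2)) : ℕ) = C at *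
  push_cast at *
  split_ifs at * <;> omega

/-- If two permutations in `𝒱_m` have the same projection, they are `θ_{a,0}` and `θ_{a,1}`. -/
theorem eq_theta_of_proj_eq_of_lt {n : ℕ} {θ θ' : Equiv.Perm (Fin (n + 2))} (hθ : θ ∈ V (n + 2))
    (hθ' : θ' ∈ V (n + 2)) (hp : proj θ = proj θ') (hlt : θ 0 < θ' 0) :
    ∃ a : ℕ, 1 ≤ a ∧ a ≤ n + 2 ∧ ∃ ha : IsCoprime (a : ℤ) ((n + 2 : ℕ) : ℤ),
      θ = theta (n + 2) a 0 ha ∧ θ' = theta (n + 2) a 1 ha := by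
  have hlt' : ((θ 0 : Fin (n + 2)) : ℕ) < (θ' 0 : Fin (n + 2)) := hlt
  have t := apply_zero_eq_of_mem_V hθ
  have t' := apply_zero_eq_of_mem_V hθ'
  rw [← hp] at t'
  have h0 : ¬ θ (Fin.last (n + 1)) ≤ θ 0 := by
    intro h
    rw [if_pos h] at t
    split_ifs at t' <;> omega
  have h00 : ((θ' 0 : Fin (n + 2)) : ℤ) = (θ 0 : Fin (n + 2)) + 1 := by
    rw [if_neg h0] at t
    split_ifs at t' <;> omega
  -- Equal projections and first entries differing by 1 force `θ' ≡ θ + 1` everywhere.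
  have hshift : ∀ k : Fin (n + 2), ((n + 2 : ℕ) : ℤ) ∣
      ((θ' k : Fin (n + 2)) : ℤ) - ((θ k : Fin (n + 2)) + 1) := by
    intro k
    cases k using Fin.cases with
    | zero => rw [h00]; simp
    | succ k =>
      have p := proj_apply θ k
      have p' := proj_apply θ' k
      rw [← hp] at p'
      rw [p] at p'
      have : ((n + 2 : ℕ) : ℤ) = n + 2 := by push_cast; rfl
      rw [this]
      push_cast at p'
      split_ifs at p'
      · exact ⟨0, by linarith⟩
      · exact ⟨-1, by linarith⟩
      · exact ⟨1, by linarith⟩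
      · exact ⟨0, by linarith⟩
  have hstep : ∀ k : Fin (n + 1), ((n + 2 : ℕ) : ℤ) ∣
      ((θ k.succ : Fin (n + 2)) : ℤ) - (θ k.castSucc : Fin (n + 2)) -
        ((θ 0 : Fin (n + 2)) + 1) := by
    intro k
    have d := (mem_V_succ_iff.mp hθ k).symm.dvd
    have d' := (mem_V_succ_iff.mp hθ' k).symm.dvd
    have hε : ¬ θ (Fin.last (n + 1)) ≤ θ k.castSucc := by
      intro hε
      -- Subtracting the two recurrences leaves `m ∣ 2` or `m ∣ 1`, impossible for `m ≥ 3`. For `m =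
      -- 2` the only index is the first, covered by `h0`.
      rcases Nat.eq_zero_or_pos n with rfl | hn
      · have : k = 0 := Fin.fin_one_eq_zero k
        subst this
        exact h0 hε
      · rw [if_pos hε] at d
        rw [h00] at d'
        have d'' := dvd_add (dvd_sub d' d) (dvd_sub (hshift k.castSucc) (hshift k.succ))
        have : ((n + 1 + 1 : ℕ) : ℤ) ∣
            2 - (if θ' (Fin.last (n + 1)) ≤ θ' k.castSucc then 1 else 0) := by
          obtain ⟨c, hc⟩ := d''
          exact ⟨-c, by linear_combination -hc⟩
        have := Int.le_of_dvd (by split_ifs <;> norm_num) this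
        push_cast at this
        split_ifs at this <;> omega
    rw [if_neg hε, sub_zero] at d
    exact d
  have hlin : ∀ k : Fin (n + 2), ((n + 2 : ℕ) : ℤ) ∣ ((θ k : Fin (n + 2)) : ℤ) + 1 -
      ((((θ 0 : Fin (n + 2)) : ℕ) + 1 : ℕ) * ((k : ℤ) + 1) + 0) := by
    intro k
    induction k using Fin.induction with
    | zero => simp
    | succ k ih =>
      obtain ⟨c, hc⟩ := dvd_add ih (hstep k)
      refine ⟨c, ?_⟩
      simp only [Fin.val_succ, Fin.val_castSucc] at hc ⊢
      push_cast at hc ⊢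
      linear_combination hc
  have hcop : IsCoprime ((((θ 0 : Fin (n + 2)) : ℕ) + 1 : ℕ) : ℤ) ((n + 2 : ℕ) : ℤ) := by
    -- The index at which `θ` takes the value 1 is an inverse of `a` modulo `m`.
    have h1 := hlin (θ.symm 0)
    rw [Equiv.apply_symm_apply] at h1
    obtain ⟨c, hc⟩ := h1
    refine ⟨((θ.symm 0 : Fin (n + 2)) : ℤ) + 1, c, ?_⟩
    simp only [Fin.val_zero] at hc
    push_cast at hc ⊢
    linear_combination -hc
  refine ⟨_, by omega, (θ 0).2, hcop, eq_theta hcop hlin, eq_theta hcop fun k => ?_⟩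
  obtain ⟨c, hc⟩ := dvd_add (hlin k) (hshift k)
  exact ⟨c, by linear_combination hc⟩

theorem children_eq_pair {n : ℕ} {h : 1 ≤ n + 2} {π : Equiv.Perm (Fin (n + 1))}
    {θ θ' : Equiv.Perm (Fin (n + 2))} (hθ : θ ∈ children (n + 2) h π)
    (hθ' : θ' ∈ children (n + 2) h π) (hne : θ ≠ θ') :
    ∃ a : ℕ, 1 ≤ a ∧ a < n + 2 ∧ ∃ ha : IsCoprime (a : ℤ) ((n + 2 : ℕ) : ℤ),
      children (n + 2) h π = {theta (n + 2) a 0 ha, theta (n + 2) a 1 ha} := by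
  wlog hlt : θ 0 < θ' 0 generalizing θ θ'
  · refine this hθ' hθ hne.symm (lt_of_le_of_ne (not_lt.mp hlt) fun he => hne ?_)
    exact proj_ext (hθ.2.trans hθ'.2.symm) he.symm
  obtain ⟨a, ha1, ha2, ha, e, e'⟩ :=
    eq_theta_of_proj_eq_of_lt hθ.1 hθ'.1 (hθ.2.trans hθ'.2.symm) hlt
  refine ⟨a, ha1, lt_of_le_of_ne ha2 ?_, ha, ?_⟩
  · rintro rfl
    rw [isCoprime_self, Int.isUnit_iff] at ha
    push_cast at ha
    omega
  · rw [← e, ← e']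
    refine Set.Subset.antisymm (fun η hη => ?_) (Set.pair_subset hθ hθ')
    have t := apply_zero_eq_of_mem_V hθ.1
    have t' := apply_zero_eq_of_mem_V hθ'.1
    have s := apply_zero_eq_of_mem_V hη.1
    rw [show proj θ = π from hθ.2] at t
    rw [show proj θ' = π from hθ'.2] at t'
    rw [show proj η = π from hη.2] at s
    have hlt' : ((θ 0 : Fin (n + 2)) : ℕ) < (θ' 0 : Fin (n + 2)) := hlt
    -- The two given children already use both admissible first entries.
    have : η 0 = θ 0 ∨ η 0 = θ' 0 := by
      simp only [Fin.ext_iff]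
      split_ifs at t t' s <;> omega
    rcases this with h0 | h0
    · exact Or.inl (proj_ext (hη.2.trans hθ.2.symm) h0)
    · exact Or.inr (proj_ext (hη.2.trans hθ'.2.symm) h0)

/-! ### Every element of `V` is a rank permutation -/

theorem exists_mem_fareyInterval_notMem_farey {m : ℕ} {I : Set ℝ} (hI : I ∈ fareyIntervals m)
    (m' : ℕ) : ∃ α ∈ I, α ∉ farey m' := by
  obtain ⟨x, -, y, -, hxy, -, rfl⟩ := hI
  exact ((Set.Ioo_infinite hxy).sdiff (finite_farey m')).nonempty

theorem exists_mem_children {n : ℕ} {h : 1 ≤ n + 2} {π : Equiv.Perm (Fin (n + 1))} {α : ℝ}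
    (hα : α ∈ F (n + 1) π) (hα' : α ∉ farey (n + 2)) :
    ∃ θ ∈ children (n + 2) h π, IsRank α θ := by
  obtain ⟨h0, h1, hπ⟩ := mem_F_iff.mp hα
  obtain ⟨θ, hθ⟩ := exists_isRank h0 h1 hα'
  exact ⟨θ, ⟨hθ.mem_V, hθ.proj.unique hπ⟩, hθ⟩

theorem F_mem_fareyIntervals {n : ℕ} {θ : Equiv.Perm (Fin (n + 1))} {α : ℝ} (h0 : 0 < α)
    (h1 : α < 1) (hθ : IsRank α θ) : F (n + 1) θ ∈ fareyIntervals (n + 1) := by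
  obtain ⟨I, hI, hα⟩ := exists_fareyInterval (by omega) h0 h1 hθ.notMem_farey
  rw [F_eq_of_mem hI hα hθ]
  exact hI

/-- Every element of `𝒱_m` is a rank permutation. -/
theorem exists_isRank_of_mem_V {n : ℕ} {θ : Equiv.Perm (Fin (n + 1))} (hθ : θ ∈ V (n + 1)) :
    ∃ α : ℝ, 0 < α ∧ α < 1 ∧ IsRank α θ := by
  induction n with
  | zero =>
    refine ⟨1 / 2, by norm_num, by norm_num, fun k => ?_, fun k l => ?_⟩
    · have : k = 0 := Fin.fin_one_eq_zero k
      subst this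
      norm_num
    · have : k = l := (Fin.fin_one_eq_zero k).trans (Fin.fin_one_eq_zero l).symm
      subst this
      simp
  | succ n ih =>
    obtain ⟨α, h0, h1, hα⟩ := ih (proj_mem_V hθ)
    obtain ⟨β, hβ, hβ'⟩ :=
      exists_mem_fareyInterval_notMem_farey (F_mem_fareyIntervals h0 h1 hα) (n + 2)
    obtain ⟨θ', hθ', hβθ'⟩ := exists_mem_children (h := by omega) hβ hβ'
    -- Either `θ` is the child ranked by `β`, or it is one of two distinct children, hence some
    -- `θ_{a,b}`, realised near `a/m`.
    by_cases hne : θ = θ'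
    · obtain ⟨h0, h1, -⟩ := mem_F_iff.mp hβ
      exact ⟨β, h0, h1, hne ▸ hβθ'⟩
    have hmem : θ ∈ children (n + 2) (by omega) (proj θ) := ⟨hθ, rfl⟩
    obtain ⟨a, ha1, ha2, ha, he⟩ := children_eq_pair hmem hθ' hne
    have hx : (0 : ℝ) < ((a : ℤ) : ℝ) / ((n + 2 : ℕ) : ℝ) := by
      rw [Int.cast_natCast]; positivity
    have hy : ((a : ℤ) : ℝ) / ((n + 2 : ℕ) : ℝ) < 1 := by
      rw [Int.cast_natCast, div_lt_one (by positivity)]; exact_mod_cast ha2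
    rw [he] at hmem
    rcases hmem with e | e
    · obtain ⟨γ, ⟨hγ0, hγ1⟩, hγ⟩ := exists_isRank_theta (by omega) ha (Or.inl rfl) hx hy
      exact ⟨γ, hγ0, hγ1, e ▸ hγ⟩
    · obtain ⟨γ, ⟨hγ0, hγ1⟩, hγ⟩ := exists_isRank_theta (by omega) ha (Or.inr rfl) hx hy
      exact ⟨γ, hγ0, hγ1, e ▸ hγ⟩

theorem F_mem_fareyIntervals_of_mem_V {n : ℕ} {θ : Equiv.Perm (Fin (n + 1))}
    (hθ : θ ∈ V (n + 1)) : F (n + 1) θ ∈ fareyIntervals (n + 1) := by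
  obtain ⟨α, h0, h1, hα⟩ := exists_isRank_of_mem_V hθ
  exact F_mem_fareyIntervals h0 h1 hα

theorem bijOn_F (n : ℕ) : Set.BijOn (F (n + 1)) (V (n + 1)) (fareyIntervals (n + 1)) := by
  refine ⟨fun θ hθ => F_mem_fareyIntervals_of_mem_V hθ, fun θ hθ θ' _ he => ?_, fun I hI => ?_⟩
  · obtain ⟨α, h0, h1, hα⟩ := exists_isRank_of_mem_V hθ
    have : α ∈ F (n + 1) θ' := he ▸ mem_F_iff.mpr ⟨h0, h1, hα⟩
    exact hα.unique (mem_F_iff.mp this).2.2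
  · obtain ⟨α, hα, -⟩ := exists_mem_fareyInterval_notMem_farey hI 0
    obtain ⟨h0, h1, h⟩ := (mem_sUnion_fareyIntervals (by omega)).mp ⟨I, hI, hα⟩
    obtain ⟨θ, hθ⟩ := exists_isRank h0 h1 h
    exact ⟨θ, hθ.mem_V, F_eq_of_mem hI hα hθ⟩

/-! ### Branching and new Farey terms -/

theorem F_subset_F_of_mem_children {n : ℕ} {h : 1 ≤ n + 2} {π : Equiv.Perm (Fin (n + 1))}
    {θ : Equiv.Perm (Fin (n + 2))} (hθ : θ ∈ children (n + 2) h π) :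
    F (n + 2) θ ⊆ F (n + 1) π := by
  intro α hα
  obtain ⟨h0, h1, hα⟩ := mem_F_iff.mp hα
  exact mem_F_iff.mpr ⟨h0, h1, hθ.2 ▸ hα.proj⟩

/-- Points close to `c/m` stay in the open interval of `π`, and `θ_{c,b}` ranks one of them. -/
theorem theta_mem_children {n : ℕ} {h : 1 ≤ n + 2} {π : Equiv.Perm (Fin (n + 1))}
    (hπ : π ∈ V (n + 1)) {c : ℕ} (hc : IsCoprime (c : ℤ) ((n + 2 : ℕ) : ℤ)) {b : ℤ}
    (hb : b = 0 ∨ b = 1) (hmem : (c : ℝ) / ((n + 2 : ℕ) : ℝ) ∈ F (n + 1) π) :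
    theta (n + 2) c b hc ∈ children (n + 2) h π := by
  obtain ⟨x, -, y, -, -, -, hF⟩ := F_mem_fareyIntervals_of_mem_V hπ
  rw [hF, ← Int.cast_natCast c] at hmem
  obtain ⟨α, hα, hθ⟩ := exists_isRank_theta (by omega) hc hb hmem.1 hmem.2
  rw [← hF] at hα
  exact ⟨hθ.mem_V, hθ.proj.unique (mem_F_iff.mp hα).2.2⟩

/-- A smaller denominator, or a common factor to cancel, would make the term an old one. -/
theorem exists_eq_div_of_mem_farey {n : ℕ} {α : ℝ} (h : α ∈ farey (n + 1)) (h' : α ∉ farey n) :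
    ∃ c : ℕ, IsCoprime (c : ℤ) ((n + 1 : ℕ) : ℤ) ∧ α = (c : ℝ) / ((n + 1 : ℕ) : ℝ) := by
  obtain ⟨h0, h1, p, q, hq, hqm, rfl⟩ := h
  obtain rfl : q = n + 1 := by
    by_contra hne
    exact h' ⟨h0, h1, p, q, hq, by omega, rfl⟩
  refine ⟨p, Nat.isCoprime_iff_coprime.mpr ?_, rfl⟩
  by_contra hcop
  have hg := Nat.gcd_pos_of_pos_right p (Nat.succ_pos n)
  obtain ⟨p', q', -, hp, hq'⟩ := Nat.exists_coprime p (n + 1)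
  have hg2 : 1 < Nat.gcd p (n + 1) := lt_of_le_of_ne hg (Ne.symm hcop)
  have hq1 : 0 < q' := Nat.pos_of_ne_zero fun h => by simp [h] at hq'
  refine h' ⟨h0, h1, p', q', hq1, by nlinarith, ?_⟩
  have hg3 : ((Nat.gcd p (n + 1) : ℕ) : ℝ) ≠ 0 := by positivity
  generalize Nat.gcd p (n + 1) = g at hp hq' hg3
  rw [hp, hq']
  push_cast
  exact mul_div_mul_right _ _ hg3

theorem div_notMem_farey {n a : ℕ} (ha : IsCoprime (a : ℤ) ((n + 1 : ℕ) : ℤ)) :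
    (a : ℝ) / ((n + 1 : ℕ) : ℝ) ∉ farey n := by
  rintro ⟨-, -, p, q, hq, hqm, he⟩
  rw [div_eq_div_iff (by positivity) (by positivity)] at he
  have he' : a * q = p * (n + 1) := by exact_mod_cast he
  have hdvd : n + 1 ∣ q :=
    (Nat.isCoprime_iff_coprime.mp ha).symm.dvd_of_dvd_mul_left ⟨p, by rw [he', mul_comm]⟩
  have := Nat.le_of_dvd hq hdvd
  omega

theorem children_of_not_branching {n : ℕ} {h : 1 ≤ n + 2} {π : Equiv.Perm (Fin (n + 1))}
    (hπ : π ∈ V (n + 1)) (hbr : ¬ Branching (n + 2) h π) :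
    ∃ θ : Equiv.Perm (Fin (n + 2)), children (n + 2) h π = {θ} ∧ F (n + 2) θ = F (n + 1) π := by
  have huniq : ∀ η ∈ children (n + 2) h π, ∀ η' ∈ children (n + 2) h π, η = η' := by
    intro η hη η' hη'
    by_contra hne
    obtain ⟨a, -, -, ha, he⟩ := children_eq_pair hη hη' hne
    refine hbr ?_
    rw [Branching, he, Set.ncard_pair (theta_zero_ne_theta_one ha ha)]
  obtain ⟨β, hβ, hβ'⟩ :=
    exists_mem_fareyInterval_notMem_farey (F_mem_fareyIntervals_of_mem_V hπ) (n + 2)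
  obtain ⟨θ, hθ, -⟩ := exists_mem_children (h := h) hβ hβ'
  refine ⟨θ, Set.eq_singleton_iff_unique_mem.mpr ⟨hθ, fun η hη => huniq η hη θ hθ⟩,
    (F_subset_F_of_mem_children hθ).antisymm fun α hα => ?_⟩
  obtain ⟨h0, h1, hαπ⟩ := mem_F_iff.mp hα
  by_cases hf : α ∈ farey (n + 2)
  -- A new Farey term in the interval of `π` would produce two distinct children.
  · obtain ⟨c, hc, rfl⟩ := exists_eq_div_of_mem_farey hf hαπ.notMem_farey
    exact absurd (huniq _ (theta_mem_children hπ hc (Or.inl rfl) hα) _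
      (theta_mem_children hπ hc (Or.inr rfl) hα)) (theta_zero_ne_theta_one hc hc)
  · obtain ⟨θ', hθ', hαθ'⟩ := exists_mem_children (h := h) hα hf
    rw [huniq θ' hθ' θ hθ] at hαθ'
    exact mem_F_iff.mpr ⟨h0, h1, hαθ'⟩

theorem theta_zero_injective {n a c : ℕ} (ha : IsCoprime (a : ℤ) ((n + 2 : ℕ) : ℤ))
    (hc : IsCoprime (c : ℤ) ((n + 2 : ℕ) : ℤ)) (ha2 : a < n + 2) (hc2 : c < n + 2)
    (h : theta (n + 2) a 0 ha = theta (n + 2) c 0 hc) : a = c := by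
  have h1 := dvd_theta_sub (b := 0) ha 0
  have h2 := dvd_theta_sub (b := 0) hc 0
  rw [h] at h1
  obtain ⟨e, he⟩ := dvd_sub h2 h1
  refine Nat.ModEq.eq_of_lt_of_lt (Int.natCast_modEq_iff.mp (Int.modEq_iff_dvd.mpr ⟨-e, ?_⟩))
    ha2 hc2
  simp only [Fin.val_zero] at he
  linear_combination -he

theorem children_of_branching {n : ℕ} {h : 1 ≤ n + 2} {π : Equiv.Perm (Fin (n + 1))}
    (hπ : π ∈ V (n + 1)) (hbr : Branching (n + 2) h π) :
    ∃ a : ℕ, 1 ≤ a ∧ a ≤ n + 2 ∧ ∃ ha : IsCoprime (a : ℤ) ((n + 2 : ℕ) : ℤ),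
      ((a : ℝ) / ((n + 2 : ℕ) : ℝ) ∈ farey (n + 2) ∧
        (a : ℝ) / ((n + 2 : ℕ) : ℝ) ∉ farey (n + 1)) ∧
      children (n + 2) h π = {theta (n + 2) a 0 ha, theta (n + 2) a 1 ha} ∧
      Disjoint (F (n + 2) (theta (n + 2) a 0 ha)) {(a : ℝ) / ((n + 2 : ℕ) : ℝ)} ∧
      Disjoint (F (n + 2) (theta (n + 2) a 1 ha)) {(a : ℝ) / ((n + 2 : ℕ) : ℝ)} ∧
      Disjoint (F (n + 2) (theta (n + 2) a 0 ha)) (F (n + 2) (theta (n + 2) a 1 ha)) ∧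
      F (n + 2) (theta (n + 2) a 0 ha) ∪ {(a : ℝ) / ((n + 2 : ℕ) : ℝ)} ∪
        F (n + 2) (theta (n + 2) a 1 ha) = F (n + 1) π := by
  obtain ⟨η, η', hne, heq⟩ := Set.ncard_eq_two.mp hbr
  obtain ⟨a, ha1, ha2, ha, he⟩ := children_eq_pair (π := π) (h := h) (θ := η) (θ' := η')
    (heq ▸ Set.mem_insert _ _) (heq ▸ Set.mem_insert_of_mem _ rfl) hne
  have hx : (0 : ℝ) < (a : ℝ) / ((n + 2 : ℕ) : ℝ) := by positivity
  have hy : (a : ℝ) / ((n + 2 : ℕ) : ℝ) < 1 := by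
    rw [div_lt_one (by positivity)]; exact_mod_cast ha2
  have hfar : (a : ℝ) / ((n + 2 : ℕ) : ℝ) ∈ farey (n + 2) :=
    ⟨hx.le, hy.le, a, n + 2, by omega, le_rfl, rfl⟩
  have hdisj : ∀ θ : Equiv.Perm (Fin (n + 2)),
      Disjoint (F (n + 2) θ) {(a : ℝ) / ((n + 2 : ℕ) : ℝ)} := fun θ =>
    Set.disjoint_singleton_right.mpr fun hmem => (mem_F_iff.mp hmem).2.2.notMem_farey hfar
  have hmem0 : theta (n + 2) a 0 ha ∈ children (n + 2) h π := he ▸ Set.mem_insert _ _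
  have hmem1 : theta (n + 2) a 1 ha ∈ children (n + 2) h π := he ▸ Set.mem_insert_of_mem _ rfl
  refine ⟨a, ha1, ha2.le, ha, ⟨hfar, div_notMem_farey ha⟩, he, hdisj _, hdisj _, ?_, ?_⟩
  · refine Set.disjoint_left.mpr fun α h0 h1 => theta_zero_ne_theta_one ha ha ?_
    exact (mem_F_iff.mp h0).2.2.unique (mem_F_iff.mp h1).2.2
  refine Set.Subset.antisymm (Set.union_subset (Set.union_subset
    (F_subset_F_of_mem_children hmem0) (Set.singleton_subset_iff.mpr ?_))
    (F_subset_F_of_mem_children hmem1)) fun α hα => ?_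
  -- The permutation `θ_{a,0}` ranks some `β` in the interval of order `n + 1` around `a/m`. Its
  -- projection `π` then ranks `β` too, so `F (n + 1) π` is that whole interval.
  · obtain ⟨I, hI, haI⟩ := exists_fareyInterval (by omega) hx hy (div_notMem_farey ha)
    obtain ⟨x, -, y, -, -, -, rfl⟩ := id hI
    rw [← Int.cast_natCast a] at haI
    obtain ⟨β, hβ, hβθ⟩ := exists_isRank_theta (by omega) ha (Or.inl rfl) haI.1 haI.2
    have hβπ : IsRank β π := (show proj _ = π from hmem0.2) ▸ hβθ.proj
    rw [F_eq_of_mem hI hβ hβπ, ← Int.cast_natCast a]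
    exact haI
  · obtain ⟨h0, h1, hαπ⟩ := mem_F_iff.mp hα
    by_cases hf : α ∈ farey (n + 2)
    · obtain ⟨c, hc, rfl⟩ := exists_eq_div_of_mem_farey hf hαπ.notMem_farey
      have hc2 : c < n + 2 := by
        rw [div_lt_one (by positivity)] at h1
        exact_mod_cast h1
      -- Any new term `c/m` in the interval gives the child `θ_{c,0}`, which can only be `θ_{a,0}`;
      -- hence `c = a`.
      have hmem := theta_mem_children (h := h) hπ hc (Or.inl rfl) hα
      rw [he] at hmem
      rcases hmem with e | e
      · rw [theta_zero_injective hc ha hc2 ha2 e]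
        exact Or.inl (Or.inr rfl)
      · exact absurd e (theta_zero_ne_theta_one hc ha)
    · obtain ⟨θ', hθ', hαθ'⟩ := exists_mem_children (h := h) hα hf
      rw [he] at hθ'
      rcases hθ' with e | e
      · exact Or.inl (Or.inl (mem_F_iff.mpr ⟨h0, h1, e ▸ hαθ'⟩))
      · exact Or.inr (mem_F_iff.mpr ⟨h0, h1, e ▸ hαθ'⟩)

end SosLift

theorem mainTheorem8 (m : ℕ) (hm : 2 ≤ m) :
    -- `F` is a bijection from `𝒱` onto the set of Farey intervals, in degrees `m - 1` and `m`
    Set.BijOn (SosLift.F (m - 1)) (SosLift.V (m - 1)) (SosLift.fareyIntervals (m - 1)) ∧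
    Set.BijOn (SosLift.F m) (SosLift.V m) (SosLift.fareyIntervals m) ∧
    ∀ π ∈ SosLift.V (m - 1),
      (¬ SosLift.Branching m (by omega) π →
        ∃ θ : Equiv.Perm (Fin m), SosLift.children m (by omega) π = {θ} ∧
          SosLift.F m θ = SosLift.F (m - 1) π) ∧
      (SosLift.Branching m (by omega) π →
        ∃ a : ℕ, 1 ≤ a ∧ a ≤ m ∧ ∃ ha : IsCoprime (a : ℤ) (m : ℤ),
          ((a : ℝ) / (m : ℝ) ∈ SosLift.farey m ∧ (a : ℝ) / (m : ℝ) ∉ SosLift.farey (m - 1)) ∧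
          SosLift.children m (by omega) π = {SosLift.theta m a 0 ha, SosLift.theta m a 1 ha} ∧
          Disjoint (SosLift.F m (SosLift.theta m a 0 ha)) {(a : ℝ) / (m : ℝ)} ∧
          Disjoint (SosLift.F m (SosLift.theta m a 1 ha)) {(a : ℝ) / (m : ℝ)} ∧
          Disjoint (SosLift.F m (SosLift.theta m a 0 ha)) (SosLift.F m (SosLift.theta m a 1 ha)) ∧
          SosLift.F m (SosLift.theta m a 0 ha) ∪ {(a : ℝ) / (m : ℝ)} ∪
              SosLift.F m (SosLift.theta m a 1 ha) =
            SosLift.F (m - 1) π) := by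
  obtain ⟨n, rfl⟩ : ∃ n, m = n + 2 := ⟨m - 2, by omega⟩
  refine ⟨SosLift.bijOn_F n, SosLift.bijOn_F (n + 1), fun π hπ => ⟨fun hbr => ?_, fun hbr => ?_⟩⟩
  · exact SosLift.children_of_not_branching hπ hbr
  · exact SosLift.children_of_branching hπ hbr
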